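/- Let $G=(V,E,w)$ be a finite weighted simple undirected graph with at least one edge and with real weights $w_e>0$. Put $W=\sum_{e\in E}w_e$. Fix an arbitrary orientation of the edges. Let $\chi_e=\mathbf e_u-\mathbf e_v\in\mathbb R^V$ for the oriented edge $e=(u,v)$. Let $B\in\mathbb R^{E\times V}$ be the boundary matrix, which has in row $e=(u,v)$ the entry $-\sqrt{w_e}$ at $u$, $\sqrt{w_e}$ at $v$, and $0$ elsewhere. Let $L=B^TB$ be the weighted Laplacian of $G$, $L^\dagger$ its Moore–Penrose pseudoinverse, $L^{-1/2}=\sqrt{L^\dagger}$, and $\kappa_2(L)=\|L\|_2\|L^\dagger\|_2$; write $\sigma_{\max}(B)=\|B\|_2$. For $r\in\mathbb N$, draw $r$ edges $e_1,\dots,e_r$ independently with replacement, edge $e$ having probability $w_e/W$ in each draw, and output $\tilde L=\sum_{i=1}^r\frac{W}{r}\,\chi_{e_i}\chi_{e_i}^T$. Assume $W\ge\sigma_{\max}(B)^2/48$, and let $\epsilon\in(0,1)$, $\delta\in(0,1]$ and $\gamma=\frac{8W}{\epsilon\,\sigma_{\max}(B)}$. Consider the assertion that $\tilde L$ is a multiplicative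 $\kappa_2(L)\epsilon$-spectral sparsifier with probability at least $1-\delta$: $$\Pr\Big[\big\|L^{-1/2}(L-\tilde L)L^{-1/2}\big\|_2\le\kappa_2(L)\cdot\epsilon\Big]\ \ge\ 1-\delta .\tag{$*$}$$ 1. There is an $r_0\in\mathbb N$ such that $(*)$ holds for all $r\ge r_0$. 2. If $w_e\ge 1$ for every edge $e$ (for instance, if all weights are positive integers), then $(*)$ holds for every $r\ge 6\gamma^2\ln\!\big(\gamma^2/\sqrt\delta\big)$. -/

import Mathlib

open scoped Matrix Matrix.Norms.L2Operator
open MeasureTheory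

namespace CRSparsifier

/-- An orientation of the edges of a simple graph: each edge gets an initial and a terminal
vertex. -/
structure EdgeOrientation {V : Type*} (G : SimpleGraph V) where
  src : G.edgeSet → V
  tgt : G.edgeSet → V
  mk_eq : ∀ e : G.edgeSet, s(src e, tgt e) = (e : Sym2 V)

section Graph

variable {V : Type*} [Fintype V] [DecidableEq V] {G : SimpleGraph V} [DecidableRel G.Adj]

/-- The total weight `W`. -/
noncomputable def totalWeight (w : G.edgeSet → ℝ) : ℝ := ∑ e, w e

/-- The Laplacian of a weighted simple graph: weighted degrees on the diagonal, minus the weights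
of the edges off the diagonal, and `0` at distinct non-adjacent vertices. -/
noncomputable def laplacian (w : G.edgeSet → ℝ) : Matrix V V ℝ := fun i j =>
  if i = j then ∑ e : G.edgeSet, if i ∈ (e : Sym2 V) then w e else 0
  else if h : G.Adj i j then - w ⟨s(i, j), h⟩ else 0

/-- The boundary matrix of a weighted simple graph for a given orientation. -/
noncomputable def boundaryMatrix (o : EdgeOrientation G) (w : G.edgeSet → ℝ) :
    Matrix G.edgeSet V ℝ := fun e v =>
  if v = o.src e then - √(w e) else if v = o.tgt e then √(w e) else 0

/-- The incidence vector `χ_e = 𝐞_u - 𝐞_v` of the oriented edge `e = (u, v)`. -/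
noncomputable def incidenceVector (o : EdgeOrientation G) (e : G.edgeSet) : V → ℝ :=
  Pi.single (o.src e) 1 - Pi.single (o.tgt e) 1

/-- Every set of edges is an event. -/
instance edgeMeasurableSpace : MeasurableSpace G.edgeSet := ⊤

/-- The law of one trial: edge `e` is drawn with probability `w e / W`. -/
noncomputable def edgeLaw (w : G.edgeSet → ℝ) : Measure G.edgeSet :=
  ∑ e, ENNReal.ofReal (w e / totalWeight w) • Measure.dirac e

/-- The law of `r` independent trials, that is, of sampling `r` edges with replacement. -/
noncomputable def sampleLaw (w : G.edgeSet → ℝ) (r : ℕ) : Measure (Fin r → G.edgeSet) :=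
  Measure.pi fun _ => edgeLaw w

/-- The output of the algorithm when the `i`-th trial draws the edge `s i`: starting from `0`, each
trial adds `(W / r) χ_e χ_eᵀ` for the drawn edge `e`. -/
noncomputable def sketchLaplacian (o : EdgeOrientation G) (w : G.edgeSet → ℝ) (r : ℕ)
    (s : Fin r → G.edgeSet) : Matrix V V ℝ :=
  ∑ i, (totalWeight w / r) •
    Matrix.vecMulVec (incidenceVector o (s i)) (incidenceVector o (s i))

end Graph

section Spectral

variable {V : Type*} [Fintype V] [DecidableEq V]

/-- The Moore-Penrose pseudoinverse of a symmetric real matrix: the nonzero eigenvalues are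
inverted and the zero eigenvalue is kept (`0⁻¹ = 0`), on the same eigenspaces. -/
noncomputable def pinv (A : Matrix V V ℝ) : Matrix V V ℝ := cfc (fun x : ℝ => x⁻¹) A

/-- `A^{-1/2}`, the square root of the pseudoinverse, for `A` symmetric positive semidefinite. -/
noncomputable def invSqrt (A : Matrix V V ℝ) : Matrix V V ℝ := cfc Real.sqrt (pinv A)

/-- The condition number `κ₂(A) = ‖A‖₂ ‖A†‖₂`; norms of matrices are spectral norms. -/
noncomputable def condNumber (A : Matrix V V ℝ) : ℝ := ‖A‖ * ‖pinv A‖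

/-- `L'` is the Laplacian of a multiplicative `ε`-spectral sparsifier of a graph with
Laplacian `L`. -/
def IsMultiplicativeSparsifier (L L' : Matrix V V ℝ) (ε : ℝ) : Prop :=
  ‖(invSqrt L)ᵀ * (L - L') * invSqrt L‖ ≤ ε

end Spectral

end CRSparsifier

/-!
Write `p e = w e / W` for the edge probabilities and `N e` for the number of times that the edge `e`
is drawn in `r` trials. With `B` the boundary matrix, `L = Bᵀ B` and
`L̃ = Bᵀ diag(N e / (r p e)) B`, so the two Laplacians differ only by a reweighting of the edges.

If every relative deviation `|1 - N e / (r p e)|` is at most `ε`, then, with `S = L^{-1/2}`,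
`‖S (L - L̃) S‖ = ‖(B S)ᵀ diag(1 - N e / (r p e)) (B S)‖ ≤ ε ‖B S‖²`, and
`‖B S‖² = ‖S L S‖ = ‖L L†‖ ≤ κ₂(L)` (`isMultiplicativeSparsifier_reweight`). It therefore suffices to
control the relative deviation of each edge count separately. Each `N e` is binomial, and the
multiplicative Chernoff bound (`measureReal_pi_count_deviation_le`) gives deviation larger than `ε`
with probability at most `2 exp (-r (p e) ε² / 4)`. A union bound over the edges
(`sampleLaw_isMultiplicativeSparsifier`) leaves the numerical condition
`2 |E| exp (-r m ε² / 4) ≤ δ`, where `m` is a lower bound for all `p e`.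

The left side tends to `0` as `r → ∞`, which is the first assertion. If all weights are at least `1`,
one may take `m = 1 / W`, and `|E| ≤ W`. As `σ_max(B)² ≤ 2 W`
(`norm_boundaryMatrix_sq_le`), the prescribed number of samples makes the exponent at least
`48 ln (γ² / √δ)` and forces `γ² ≥ 32 W`, which is far more than the union bound requires.
-/

namespace CRSparsifier

/-! ### The multiplicative Chernoff bound -/

section Chernoff

variable {α : Type*} [MeasurableSpace α] (μ : Measure α) [IsProbabilityMeasure μ] {A : Set α}

/-- The centred moment generating function of an event of probability `p` is at most `exp (p t²)`
for `|t| ≤ 1`; the factor `p` in the exponent is what makes the resulting tail bound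
multiplicative. -/
lemma integral_exp_indicator_sub_le (hA : MeasurableSet A) {t : ℝ} (ht : |t| ≤ 1) :
    ∫ x, Real.exp (t * (A.indicator 1 x - μ.real A)) ∂μ ≤ Real.exp (μ.real A * t ^ 2) := by
  set p := μ.real A with hp
  have hp0 : 0 ≤ p := measureReal_nonneg
  have h1 : ∀ x, Real.exp (t * (A.indicator 1 x - p)) =
      Real.exp (-(t * p)) * (1 + (Real.exp t - 1) * A.indicator 1 x) := by
    intro x
    by_cases hx : x ∈ A
    · simp only [Set.indicator_of_mem hx, Pi.one_apply]
      rw [mul_sub, sub_eq_add_neg, Real.exp_add]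
      ring_nf
    · simp [Set.indicator_of_notMem hx]
  have h2 : Integrable (A.indicator (1 : α → ℝ)) μ := (integrable_const (1 : ℝ)).indicator hA
  have h3 : ∫ x, Real.exp (t * (A.indicator 1 x - p)) ∂μ =
      Real.exp (-(t * p)) * (1 + (Real.exp t - 1) * p) := by
    simp_rw [h1]
    rw [integral_const_mul, integral_add (integrable_const _) (h2.const_mul _),
      integral_const_mul, integral_indicator_one hA]
    simp [hp]
  have h4 : Real.exp t - 1 ≤ t + t ^ 2 := by
    linarith [(abs_le.1 (Real.abs_exp_sub_one_sub_id_le ht)).2]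
  have h5 : 1 + (Real.exp t - 1) * p ≤ Real.exp (t * p + p * t ^ 2) := by
    refine le_trans ?_ (Real.add_one_le_exp _)
    nlinarith
  calc _ ≤ Real.exp (-(t * p)) * Real.exp (t * p + p * t ^ 2) := by
        rw [h3]; gcongr
    _ = _ := by rw [← Real.exp_add]; ring_nf

/-- One-sided exponential tail bound for the number of occurrences of `A` in `r` independent
trials; the sign of `t` selects the tail. -/
lemma measureReal_pi_count_tail_le (hA : MeasurableSet A) (r : ℕ) {t : ℝ} (ht : |t| ≤ 1) (a : ℝ) :
    (Measure.pi fun _ : Fin r => μ).real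
        {s | a ≤ t * ∑ i, (A.indicator 1 (s i) - μ.real A)} ≤
      Real.exp (r * (μ.real A * t ^ 2) - a) := by
  set f : α → ℝ := fun x => Real.exp (t * (A.indicator 1 x - μ.real A)) with hf
  have hfm : Measurable f := by
    have : Measurable (A.indicator (1 : α → ℝ)) := measurable_one.indicator hA
    fun_prop
  have hfb : ∀ x, ‖f x‖ ≤ Real.exp 1 := by
    intro x
    rw [Real.norm_of_nonneg (Real.exp_nonneg _), Real.exp_le_exp]
    refine (le_abs_self _).trans ?_
    rw [abs_mul]
    have h1 : |A.indicator (1 : α → ℝ) x - μ.real A| ≤ 1 := by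
      have := measureReal_nonneg (μ := μ) (s := A)
      have := measureReal_le_one (μ := μ) (s := A)
      by_cases hx : x ∈ A <;> simp only [hx, Set.indicator_of_mem, Set.indicator_of_notMem,
        not_false_eq_true, Pi.one_apply, abs_le] <;> constructor <;> linarith
    nlinarith [abs_nonneg t, abs_nonneg (A.indicator (1 : α → ℝ) x - μ.real A)]
  have hint : Integrable f μ := .of_bound hfm.aestronglyMeasurable _ (ae_of_all _ hfb)
  have hprod : ∀ s : Fin r → α, ∏ i, f (s i) =
      Real.exp (t * ∑ i, (A.indicator 1 (s i) - μ.real A)) := by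
    intro s
    rw [Finset.mul_sum, Real.exp_sum]
  have h1 := mul_meas_ge_le_integral_of_nonneg (μ := Measure.pi fun _ : Fin r => μ)
    (f := fun s => ∏ i, f (s i))
    (ae_of_all _ fun s => Finset.prod_nonneg fun i _ => Real.exp_nonneg _)
    (.fintype_prod fun _ => hint) (Real.exp a)
  rw [integral_fintype_prod_eq_pow, Fintype.card_fin] at h1
  simp_rw [hprod, Real.exp_le_exp] at h1
  have h2 : (∫ x, f x ∂μ) ^ r ≤ Real.exp (r * (μ.real A * t ^ 2)) := by
    rw [Real.exp_nat_mul]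
    exact pow_le_pow_left₀ (integral_nonneg fun _ => Real.exp_nonneg _)
      (integral_exp_indicator_sub_le μ hA ht) r
  rw [Real.exp_sub, le_div_iff₀ (Real.exp_pos a), mul_comm]
  exact h1.trans h2

/-- Multiplicative Chernoff bound: the number of occurrences of an event in `r` independent trials
deviates from its mean by a relative error `ε` with probability at most `2 exp (-r p ε² / 4)`. -/
lemma measureReal_pi_count_deviation_le (hA : MeasurableSet A) (r : ℕ) {ε : ℝ}
    (hε : 0 < ε) (hε1 : ε < 1) :
    (Measure.pi fun _ : Fin r => μ).real
        {s | ε * (r * μ.real A) ≤ |∑ i, (A.indicator 1 (s i) - μ.real A)|} ≤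
      2 * Real.exp (-(r * μ.real A * ε ^ 2 / 4)) := by
  -- `t = ± ε / 2` minimises the exponent `p t² - |t| ε p`.
  have h1 := measureReal_pi_count_tail_le μ hA r (t := ε / 2)
    (by rw [abs_of_pos] <;> linarith) (ε / 2 * (ε * (r * μ.real A)))
  have h2 := measureReal_pi_count_tail_le μ hA r (t := -(ε / 2))
    (by rw [abs_neg, abs_of_pos] <;> linarith) (ε / 2 * (ε * (r * μ.real A)))
  rw [show (r : ℝ) * (μ.real A * (ε / 2) ^ 2) - ε / 2 * (ε * (r * μ.real A)) =
    -(r * μ.real A * ε ^ 2 / 4) by ring] at h1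
  rw [show (r : ℝ) * (μ.real A * (-(ε / 2)) ^ 2) - ε / 2 * (ε * (r * μ.real A)) =
    -(r * μ.real A * ε ^ 2 / 4) by ring] at h2
  rw [two_mul]
  refine le_trans ?_ (add_le_add h1 h2)
  refine le_trans (measureReal_mono ?_) (measureReal_union_le _ _)
  intro s hs
  rcases le_abs.1 (Set.mem_ofPred_eq ▸ hs) with h | h
  · left
    exact mul_le_mul_of_nonneg_left h (by positivity)
  · right
    rw [Set.mem_ofPred_eq, neg_mul, ← mul_neg]
    exact mul_le_mul_of_nonneg_left h (by positivity)

end Chernoff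

/-! ### Edge probabilities -/

section EdgeLaw

variable {V : Type*} [Fintype V] {G : SimpleGraph V} [DecidableRel G.Adj] (w : G.edgeSet → ℝ)

lemma totalWeight_pos (hG : G.edgeSet.Nonempty) (hw : ∀ e, 0 < w e) : 0 < totalWeight w :=
  Finset.sum_pos (fun e _ => hw e) ⟨⟨hG.some, hG.some_mem⟩, Finset.mem_univ _⟩

lemma edgeLaw_real_singleton (hG : G.edgeSet.Nonempty) (hw : ∀ e, 0 < w e) (e : G.edgeSet) :
    (edgeLaw w).real {e} = w e / totalWeight w := by
  have hW := totalWeight_pos w hG hw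
  have h : edgeLaw w {e} = ENNReal.ofReal (w e / totalWeight w) := by
    rw [edgeLaw, Measure.finsetSum_apply, Finset.sum_eq_single e]
    · simp
    · intro f _ hf
      simp [hf]
    · simp
  rw [measureReal_def, h, ENNReal.toReal_ofReal (div_nonneg (hw e).le hW.le)]

lemma isProbabilityMeasure_edgeLaw (hG : G.edgeSet.Nonempty) (hw : ∀ e, 0 < w e) :
    IsProbabilityMeasure (edgeLaw w) := by
  have hW := totalWeight_pos w hG hw
  constructor
  rw [edgeLaw, Measure.finsetSum_apply]
  simp only [Measure.smul_apply, measure_univ, smul_eq_mul, mul_one]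
  rw [← ENNReal.ofReal_sum_of_nonneg fun e _ => div_nonneg (hw e).le hW.le, ← Finset.sum_div,
    ← totalWeight, div_self hW.ne', ENNReal.ofReal_one]

end EdgeLaw

/-! ### Laplacians as congruences of diagonal matrices -/

section Graph

variable {V : Type*} {G : SimpleGraph V} (o : EdgeOrientation G) (w : G.edgeSet → ℝ)

lemma EdgeOrientation.adj (e : G.edgeSet) : G.Adj (o.src e) (o.tgt e) := by
  have h := e.2
  rwa [← o.mk_eq e, SimpleGraph.mem_edgeSet] at h

lemma EdgeOrientation.src_ne_tgt (e : G.edgeSet) : o.src e ≠ o.tgt e := (o.adj e).ne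

variable [DecidableEq V]

lemma boundaryMatrix_apply (e : G.edgeSet) (v : V) :
    boundaryMatrix o w e v = -√(w e) * incidenceVector o e v := by
  have h := o.src_ne_tgt e
  unfold boundaryMatrix incidenceVector
  by_cases h1 : v = o.src e
  · simp [h1, h]
  · by_cases h2 : v = o.tgt e
    · simp [h2, h.symm]
    · simp [h1, h2]

variable [Fintype V] [DecidableRel G.Adj]

lemma boundaryMatrix_transpose_mul_diagonal_mul_apply (hw : ∀ e, 0 ≤ w e) (c : G.edgeSet → ℝ)
    (i j : V) :
    ((boundaryMatrix o w)ᵀ * Matrix.diagonal c * boundaryMatrix o w) i j =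
      ∑ e, c e * w e * (incidenceVector o e i * incidenceVector o e j) := by
  rw [Matrix.mul_apply]
  refine Finset.sum_congr rfl fun e _ => ?_
  rw [Matrix.mul_diagonal, Matrix.transpose_apply, boundaryMatrix_apply, boundaryMatrix_apply]
  linear_combination c e * (incidenceVector o e i * incidenceVector o e j) * Real.mul_self_sqrt (hw e)

lemma laplacian_eq_transpose_mul (hw : ∀ e, 0 ≤ w e) :
    laplacian w = (boundaryMatrix o w)ᵀ * boundaryMatrix o w := by
  ext i j
  have h := boundaryMatrix_transpose_mul_diagonal_mul_apply o w hw (fun _ => 1) i j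
  rw [Matrix.diagonal_one, Matrix.mul_one] at h
  rw [h]
  unfold laplacian
  have hmem : ∀ (e : G.edgeSet) (v : V), v ∈ (e : Sym2 V) ↔ v = o.src e ∨ v = o.tgt e := by
    intro e v
    rw [← o.mk_eq e, Sym2.mem_iff]
  split_ifs with hij hadj
  · subst hij
    refine Finset.sum_congr rfl fun e _ => ?_
    have hne := o.src_ne_tgt e
    simp only [hmem]
    unfold incidenceVector
    by_cases h1 : i = o.src e
    · simp [h1, hne]
    · by_cases h2 : i = o.tgt e
      · simp [h2, hne.symm]
      · simp [h1, h2]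
  · rw [Finset.sum_eq_single ⟨s(i, j), hadj⟩]
    · have h1 := o.mk_eq ⟨s(i, j), hadj⟩
      have hne := o.src_ne_tgt ⟨s(i, j), hadj⟩
      rcases Sym2.eq_iff.1 h1 with ⟨h2, h3⟩ | ⟨h2, h3⟩ <;>
        simp [incidenceVector, h2, h3, hij, Ne.symm hij]
    · intro e _ he
      have hne : s(o.src e, o.tgt e) ≠ s(i, j) := fun h => he (Subtype.ext ((o.mk_eq e).symm.trans h))
      rw [Ne, Sym2.eq_iff] at hne
      unfold incidenceVector
      simp only [Pi.sub_apply, Pi.single_apply]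
      have := o.src_ne_tgt e
      split_ifs <;> simp_all
    · simp
  · symm
    refine Finset.sum_eq_zero fun e _ => ?_
    have ha := o.adj e
    unfold incidenceVector
    simp only [Pi.sub_apply, Pi.single_apply]
    have hb := ha.symm
    split_ifs <;> simp_all

/-- The sampled Laplacian is the Laplacian of the same graph with edge `e` reweighted by the factor
`N e / (r p e)`, where `N e` counts the draws of `e` and `p e = w e / W`. -/
lemma sketchLaplacian_eq_transpose_mul (hw : ∀ e, 0 < w e) (r : ℕ) (s : Fin r → G.edgeSet) :
    sketchLaplacian o w r s = (boundaryMatrix o w)ᵀ *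
      Matrix.diagonal (fun e => (∑ i, ({e} : Set G.edgeSet).indicator 1 (s i)) /
        (r * (w e / totalWeight w))) * boundaryMatrix o w := by
  classical
  ext i j
  rw [boundaryMatrix_transpose_mul_diagonal_mul_apply o w fun e => (hw e).le]
  unfold sketchLaplacian
  simp only [Matrix.sum_apply, Matrix.smul_apply, Matrix.vecMulVec_apply, smul_eq_mul]
  have h1 : ∀ e, (∑ k, ({e} : Set G.edgeSet).indicator (1 : G.edgeSet → ℝ) (s k)) /
        (r * (w e / totalWeight w)) * w e *
        (incidenceVector o e i * incidenceVector o e j) =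
      ∑ k, ({e} : Set G.edgeSet).indicator (1 : G.edgeSet → ℝ) (s k) *
        (totalWeight w / r * (incidenceVector o e i * incidenceVector o e j)) := by
    intro e
    rw [← Finset.sum_mul]
    have h2 : (r * (w e / totalWeight w))⁻¹ * w e = totalWeight w / r := by
      rw [mul_inv, inv_div]
      field_simp [(hw e).ne']
    rw [div_eq_mul_inv, ← h2]
    ring
  simp_rw [h1]
  rw [Finset.sum_comm]
  refine Finset.sum_congr rfl fun k _ => ?_
  rw [Finset.sum_eq_single (s k)]
  · simp
  · intro e _ he
    simp [he.symm]
  · simp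

/-! ### Spectral estimates -/

lemma norm_boundaryMatrix_sq_le (hw : ∀ e, 0 ≤ w e) :
    ‖boundaryMatrix o w‖ ^ 2 ≤ 2 * totalWeight w := by
  have hW : 0 ≤ totalWeight w := Finset.sum_nonneg fun e _ => hw e
  have h : ‖boundaryMatrix o w‖ ≤ √(2 * totalWeight w) := by
    rw [Matrix.l2_opNorm_def]
    refine ContinuousLinearMap.opNorm_le_bound _ (Real.sqrt_nonneg _) fun x => ?_
    rw [← sq_le_sq₀ (norm_nonneg _) (by positivity), mul_pow, Real.sq_sqrt (by positivity),
      EuclideanSpace.norm_sq_eq]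
    have hcoord : ∀ e, ((((Matrix.toEuclideanLin (𝕜 := ℝ)).trans LinearMap.toContinuousLinearMap)
        (boundaryMatrix o w)) x) e = -√(w e) * (x (o.src e) - x (o.tgt e)) := by
      intro e
      change (boundaryMatrix o w).mulVec x e = _
      simp only [Matrix.mulVec, dotProduct, boundaryMatrix_apply, mul_assoc]
      rw [← Finset.mul_sum]
      simp [incidenceVector, sub_mul, Finset.sum_sub_distrib, Pi.single_apply]
    simp_rw [hcoord]
    rw [totalWeight, Finset.mul_sum, Finset.sum_mul]
    refine Finset.sum_le_sum fun e _ => ?_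
    rw [Real.norm_eq_abs, sq_abs, mul_pow, neg_sq, Real.sq_sqrt (hw e)]
    have h2 : x (o.src e) ^ 2 + x (o.tgt e) ^ 2 ≤ ‖x‖ ^ 2 := by
      rw [EuclideanSpace.norm_sq_eq, ← Finset.sum_pair (f := fun v => x v ^ 2) (o.src_ne_tgt e)]
      simp only [Real.norm_eq_abs, sq_abs]
      exact Finset.sum_le_sum_of_subset_of_nonneg (Finset.subset_univ _) fun _ _ _ => sq_nonneg _
    have h3 : (x (o.src e) - x (o.tgt e)) ^ 2 ≤ 2 * ‖x‖ ^ 2 := by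
      nlinarith [sq_nonneg (x (o.src e) + x (o.tgt e))]
    nlinarith [hw e]
  calc _ ≤ √(2 * totalWeight w) ^ 2 := by gcongr
    _ = _ := Real.sq_sqrt (by positivity)

lemma norm_boundaryMatrix_pos (hG : G.edgeSet.Nonempty) (hw : ∀ e, 0 < w e) :
    0 < ‖boundaryMatrix o w‖ := by
  obtain ⟨e, he⟩ := hG
  rw [norm_pos_iff]
  intro h
  have h1 := congrFun (congrFun h ⟨e, he⟩) (o.src ⟨e, he⟩)
  simp only [boundaryMatrix, if_true, Matrix.zero_apply, neg_eq_zero] at h1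
  exact (Real.sqrt_pos.2 (hw ⟨e, he⟩)).ne' h1

lemma transpose_invSqrt (A : Matrix V V ℝ) : (invSqrt A)ᵀ = invSqrt A := by
  have h : IsSelfAdjoint (invSqrt A) := cfc_predicate _ _
  rw [← Matrix.conjTranspose_eq_transpose_of_trivial]
  exact h

/-- `A^{-1/2} A A^{-1/2} = A A†`, the orthogonal projection onto the range of `A`. -/
lemma invSqrt_mul_mul_invSqrt {A : Matrix V V ℝ} (hA : A.PosSemidef) :
    invSqrt A * A * invSqrt A = A * pinv A := by
  have hs : IsSelfAdjoint A := hA.isHermitian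
  have hc : ∀ f : ℝ → ℝ, ContinuousOn f (spectrum ℝ A) := fun f =>
    (Matrix.finite_real_spectrum (A := A)).continuousOn f
  have h1 : invSqrt A = cfc (fun x : ℝ => √(x⁻¹)) A := by
    unfold invSqrt pinv
    rw [← cfc_comp' Real.sqrt (fun x : ℝ => x⁻¹) A Real.continuous_sqrt.continuousOn (hc _)]
  rw [h1, pinv]
  nth_rewrite 2 [← cfc_id' ℝ A]
  nth_rewrite 4 [← cfc_id' ℝ A]
  rw [← cfc_mul _ _ A (hc _) (hc _), ← cfc_mul _ _ A (hc _) (hc _), ← cfc_mul _ _ A (hc _) (hc _)]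
  refine cfc_congr fun x hx => ?_
  have hx0 : 0 ≤ x := by
    rw [hA.isHermitian.spectrum_real_eq_range_eigenvalues] at hx
    obtain ⟨i, rfl⟩ := hx
    exact hA.eigenvalues_nonneg i
  change √(x⁻¹) * x * √(x⁻¹) = x * x⁻¹
  linear_combination x * Real.mul_self_sqrt (inv_nonneg.2 hx0)

/-- Reweighting every edge by a factor within `ε` of `1` gives a multiplicative
`κ₂(L) ε`-sparsifier. -/
lemma isMultiplicativeSparsifier_reweight (hw : ∀ e, 0 ≤ w e) {c : G.edgeSet → ℝ} {ε : ℝ}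
    (hε : 0 ≤ ε) (hc : ∀ e, |1 - c e| ≤ ε) :
    IsMultiplicativeSparsifier (laplacian w)
      ((boundaryMatrix o w)ᵀ * Matrix.diagonal c * boundaryMatrix o w)
      (condNumber (laplacian w) * ε) := by
  classical
  unfold IsMultiplicativeSparsifier
  set B := boundaryMatrix o w
  set S := invSqrt (laplacian w)
  have hL : laplacian w = Bᵀ * B := laplacian_eq_transpose_mul o w hw
  have hpsd : (laplacian w).PosSemidef := by
    rw [hL, ← Matrix.conjTranspose_eq_transpose_of_trivial]
    exact Matrix.posSemidef_conjTranspose_mul_self B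
  have h1 : Sᵀ * (laplacian w - Bᵀ * Matrix.diagonal c * B) * S =
      (B * S)ᴴ * Matrix.diagonal (fun e => 1 - c e) * (B * S) := by
    have : (Matrix.diagonal (fun e => 1 - c e) : Matrix G.edgeSet G.edgeSet ℝ) =
        1 - Matrix.diagonal c := by
      rw [← Matrix.diagonal_one, Matrix.diagonal_sub]
    rw [this, hL, Matrix.conjTranspose_eq_transpose_of_trivial, Matrix.transpose_mul]
    simp only [Matrix.mul_sub, Matrix.sub_mul, Matrix.mul_one, Matrix.mul_assoc]
  have h2 : ‖B * S‖ * ‖B * S‖ ≤ condNumber (laplacian w) := by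
    rw [← Matrix.l2_opNorm_conjTranspose_mul_self, Matrix.conjTranspose_eq_transpose_of_trivial,
      Matrix.transpose_mul, Matrix.mul_assoc, ← Matrix.mul_assoc Bᵀ, ← hL, ← Matrix.mul_assoc,
      transpose_invSqrt, invSqrt_mul_mul_invSqrt hpsd]
    exact norm_mul_le _ _
  have h3 : ‖(Matrix.diagonal (fun e => 1 - c e) : Matrix G.edgeSet G.edgeSet ℝ)‖ ≤ ε := by
    rw [Matrix.l2_opNorm_diagonal, pi_norm_le_iff_of_nonneg hε]
    exact hc
  calc _ ≤ ‖(B * S)ᴴ‖ * ‖(Matrix.diagonal (fun e => 1 - c e) : Matrix G.edgeSet G.edgeSet ℝ)‖ *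
        ‖B * S‖ := by
        rw [h1]
        refine (Matrix.l2_opNorm_mul _ _).trans ?_
        gcongr
        exact Matrix.l2_opNorm_mul _ _
    _ = ‖B * S‖ * ‖B * S‖ *
        ‖(Matrix.diagonal (fun e => 1 - c e) : Matrix G.edgeSet G.edgeSet ℝ)‖ := by
        rw [Matrix.l2_opNorm_conjTranspose]; ring
    _ ≤ _ := by gcongr; exact (mul_self_nonneg _).trans h2

/-! ### Sampling edges -/

/-- Sampling `r` edges succeeds with probability at least `1 - δ` as soon as the union bound over
the edges does; here `m` is a lower bound for the edge probabilities. -/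
lemma sampleLaw_isMultiplicativeSparsifier (hG : G.edgeSet.Nonempty) (hw : ∀ e, 0 < w e)
    {ε δ m : ℝ} (hε : ε ∈ Set.Ioo (0 : ℝ) 1) {r : ℕ} (hr : 0 < r)
    (hm : ∀ e, m ≤ w e / totalWeight w)
    (h : Fintype.card G.edgeSet * (2 * Real.exp (-(r * m * ε ^ 2 / 4))) ≤ δ) :
    ENNReal.ofReal (1 - δ) ≤ sampleLaw w r
        {s | IsMultiplicativeSparsifier (laplacian w) (sketchLaplacian o w r s)
          (condNumber (laplacian w) * ε)} := by
  have hW := totalWeight_pos w hG hw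
  have := isProbabilityMeasure_edgeLaw w hG hw
  have hprob : IsProbabilityMeasure (sampleLaw w r) := by unfold sampleLaw; infer_instance
  set good : Set (Fin r → G.edgeSet) := {s | IsMultiplicativeSparsifier (laplacian w)
    (sketchLaplacian o w r s) (condNumber (laplacian w) * ε)} with hgood
  set bad : G.edgeSet → Set (Fin r → G.edgeSet) := fun e =>
    {s | ε * (r * (edgeLaw w).real {e}) ≤
      |∑ i, (({e} : Set G.edgeSet).indicator 1 (s i) - (edgeLaw w).real {e})|} with hbad
  have hbad_le : ∀ e, (sampleLaw w r).real (bad e) ≤ 2 * Real.exp (-(r * m * ε ^ 2 / 4)) := by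
    intro e
    refine (measureReal_pi_count_deviation_le (edgeLaw w) (A := {e}) trivial r hε.1 hε.2).trans ?_
    rw [edgeLaw_real_singleton w hG hw]
    gcongr
    exact hm e
  have hcover : Set.univ ⊆ good ∪ ⋃ e ∈ Finset.univ, bad e := by
    intro s _
    by_contra hs
    simp only [Set.mem_union, Set.mem_iUnion, not_or, not_exists, Finset.mem_univ,
      forall_true_left] at hs
    refine hs.1 ?_
    rw [hgood, Set.mem_ofPred_eq, sketchLaplacian_eq_transpose_mul o w hw]
    refine isMultiplicativeSparsifier_reweight o w (fun e => (hw e).le) hε.1.le fun e => ?_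
    have hs2 := hs.2 e
    rw [hbad, Set.mem_ofPred_eq, not_le, edgeLaw_real_singleton w hG hw, Finset.sum_sub_distrib,
      Finset.sum_const, Finset.card_univ, Fintype.card_fin, nsmul_eq_mul] at hs2
    have hp : 0 < (r : ℝ) * (w e / totalWeight w) :=
      mul_pos (Nat.cast_pos.2 hr) (div_pos (hw e) hW)
    rw [one_sub_div hp.ne', abs_div, abs_of_pos hp, div_le_iff₀ hp, abs_sub_comm]
    exact hs2.le
  have h1 : 1 ≤ (sampleLaw w r).real good + δ := by
    calc (1 : ℝ) = (sampleLaw w r).real Set.univ := by simp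
      _ ≤ (sampleLaw w r).real (good ∪ ⋃ e ∈ Finset.univ, bad e) := measureReal_mono hcover
      _ ≤ (sampleLaw w r).real good + (sampleLaw w r).real (⋃ e ∈ Finset.univ, bad e) :=
        measureReal_union_le _ _
      _ ≤ (sampleLaw w r).real good + ∑ e, (sampleLaw w r).real (bad e) := by
        gcongr; exact measureReal_biUnion_finset_le _ _
      _ ≤ (sampleLaw w r).real good + ∑ e : G.edgeSet, 2 * Real.exp (-(r * m * ε ^ 2 / 4)) := by
        gcongr with e; exact hbad_le e
      _ ≤ _ := by
        rw [Finset.sum_const, Finset.card_univ, nsmul_eq_mul]; gcongr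
  rw [← ofReal_measureReal]
  exact ENNReal.ofReal_le_ofReal (by linarith)

end Graph

/-! ### The number of samples -/

/-- The numerical content of the explicit sample size: `n` is the number of edges, `W` the total
weight and `σ` the norm of the boundary matrix. The sample size is positive, and the union bound
with edge probabilities at least `1 / W` succeeds. -/
lemma union_bound_of_sample_size {n W σ ε δ γ r : ℝ} (hW : 1 ≤ W) (hn : n ≤ W)
    (hσ : 0 < σ) (hσW : σ ^ 2 ≤ 2 * W) (hε : ε ∈ Set.Ioo (0 : ℝ) 1) (hδ : δ ∈ Set.Ioc (0 : ℝ) 1)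
    (hγ : γ = 8 * W / (ε * σ)) (hr : 6 * γ ^ 2 * Real.log (γ ^ 2 / √δ) ≤ r) :
    0 < r ∧ n * (2 * Real.exp (-(r * (1 / W) * ε ^ 2 / 4))) ≤ δ := by
  obtain ⟨hε0, hε1⟩ := hε
  obtain ⟨hδ0, hδ1⟩ := hδ
  have hγσ : γ ^ 2 * (ε ^ 2 * σ ^ 2) = 64 * W ^ 2 := by
    rw [hγ]; field_simp; ring
  have hγε : 32 * W ≤ γ ^ 2 * ε ^ 2 := by
    have h1 : γ ^ 2 * ε ^ 2 * σ ^ 2 ≤ γ ^ 2 * ε ^ 2 * (2 * W) := by gcongr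
    nlinarith
  have hγW : 32 * W ≤ γ ^ 2 := by
    have : ε ^ 2 ≤ 1 := by nlinarith
    nlinarith [sq_nonneg γ]
  have hsδ : 0 < √δ := Real.sqrt_pos.2 hδ0
  have hsδ1 : √δ ≤ 1 := Real.sqrt_le_one.2 hδ1
  have hγpos : 0 < γ ^ 2 := by linarith
  set y := γ ^ 2 / √δ with hy
  have hyγ : γ ^ 2 ≤ y := by
    rw [hy, le_div_iff₀ hsδ]; nlinarith
  have hy1 : 1 < y := by linarith
  have hlog : 0 < Real.log y := Real.log_pos hy1
  refine ⟨lt_of_lt_of_le (by positivity) hr, ?_⟩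
  -- The exponent is even `48 * Real.log y`, but `y⁻² = δ / γ⁴` already absorbs `2 n ≤ 2 W`.
  have hexp : 2 * Real.log y ≤ r * (1 / W) * ε ^ 2 / 4 := by
    have h1 : 6 * γ ^ 2 * Real.log y * ε ^ 2 ≤ r * ε ^ 2 := by gcongr
    have h2 : 32 * W * Real.log y ≤ γ ^ 2 * ε ^ 2 * Real.log y := by gcongr
    rw [show r * (1 / W) * ε ^ 2 / 4 = r * ε ^ 2 / (4 * W) by field_simp,
      le_div_iff₀ (by linarith)]
    nlinarith [mul_pos hlog (by linarith : (0 : ℝ) < W)]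
  have hexp2 : Real.exp (-(r * (1 / W) * ε ^ 2 / 4)) ≤ (y ^ 2)⁻¹ := by
    rw [Real.exp_neg]
    refine inv_anti₀ (by positivity) ?_
    calc y ^ 2 = Real.exp (2 * Real.log y) := by
          rw [two_mul, Real.exp_add, Real.exp_log (by linarith), sq]
      _ ≤ _ := Real.exp_le_exp.2 hexp
  have hy2 : (y ^ 2)⁻¹ = δ / (γ ^ 2) ^ 2 := by
    rw [hy, div_pow, Real.sq_sqrt hδ0.le, inv_div]
  calc _ ≤ W * (2 * (y ^ 2)⁻¹) := by gcongr
    _ = 2 * W * δ / (γ ^ 2) ^ 2 := by rw [hy2]; ring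
    _ ≤ δ := by
      rw [div_le_iff₀ (by positivity)]
      have : 2 * W ≤ (γ ^ 2) ^ 2 := by nlinarith
      nlinarith

end CRSparsifier

theorem mainTheorem2 {V : Type*} [Fintype V] [DecidableEq V]
    (G : SimpleGraph V) [DecidableRel G.Adj] (hG : G.edgeSet.Nonempty)
    (w : G.edgeSet → ℝ) (hw : ∀ e, 0 < w e) (o : CRSparsifier.EdgeOrientation G)
    (hW : ‖CRSparsifier.boundaryMatrix o w‖ ^ 2 / 48 ≤ CRSparsifier.totalWeight w)
    (ε : ℝ) (hε : ε ∈ Set.Ioo (0 : ℝ) 1) (δ : ℝ) (hδ : δ ∈ Set.Ioc (0 : ℝ) 1)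
    (γ : ℝ)
    (hγ : γ = 8 * CRSparsifier.totalWeight w / (ε * ‖CRSparsifier.boundaryMatrix o w‖)) :
    (∃ r₀ : ℕ, ∀ r : ℕ, r₀ ≤ r →
      ENNReal.ofReal (1 - δ) ≤ CRSparsifier.sampleLaw w r
        {s | CRSparsifier.IsMultiplicativeSparsifier (CRSparsifier.laplacian w)
          (CRSparsifier.sketchLaplacian o w r s)
          (CRSparsifier.condNumber (CRSparsifier.laplacian w) * ε)}) ∧
    ((∀ e, 1 ≤ w e) → ∀ r : ℕ, 6 * γ ^ 2 * Real.log (γ ^ 2 / √δ) ≤ r →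
      ENNReal.ofReal (1 - δ) ≤ CRSparsifier.sampleLaw w r
        {s | CRSparsifier.IsMultiplicativeSparsifier (CRSparsifier.laplacian w)
          (CRSparsifier.sketchLaplacian o w r s)
          (CRSparsifier.condNumber (CRSparsifier.laplacian w) * ε)}) := by
  have hW0 := CRSparsifier.totalWeight_pos w hG hw
  have hr_lim : ∀ m : ℝ, 0 < m → ∃ r₀ : ℕ, ∀ r : ℕ, r₀ ≤ r → 0 < r ∧
      Fintype.card G.edgeSet * (2 * Real.exp (-(r * m * ε ^ 2 / 4))) ≤ δ := by
    intro m hm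
    have hk : 0 < m * ε ^ 2 / 4 := by have := hε.1; positivity
    have h1 : Filter.Tendsto (fun r : ℕ => (r : ℝ) * (m * ε ^ 2 / 4)) Filter.atTop Filter.atTop :=
      tendsto_natCast_atTop_atTop.atTop_mul_const hk
    have h2 := ((Real.tendsto_exp_neg_atTop_nhds_zero.comp h1).const_mul
      (2 : ℝ)).const_mul (Fintype.card G.edgeSet : ℝ)
    simp only [mul_zero] at h2
    have h3 := (h2.eventually (ge_mem_nhds hδ.1)).and (Filter.eventually_gt_atTop 0)
    obtain ⟨r₀, hr₀⟩ := Filter.eventually_atTop.1 h3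
    refine ⟨r₀, fun r hr => ⟨(hr₀ r hr).2, ?_⟩⟩
    have h4 := (hr₀ r hr).1
    rwa [Function.comp_apply, show (r : ℝ) * (m * ε ^ 2 / 4) = r * m * ε ^ 2 / 4 by ring] at h4
  refine ⟨?_, fun hw1 r hr => ?_⟩
  · have : Nonempty G.edgeSet := hG.to_subtype
    obtain ⟨e₀, he₀⟩ := Finite.exists_min w
    obtain ⟨r₀, hr₀⟩ := hr_lim (w e₀ / CRSparsifier.totalWeight w) (div_pos (hw e₀) hW0)
    refine ⟨r₀, fun r hr => ?_⟩
    exact CRSparsifier.sampleLaw_isMultiplicativeSparsifier o w hG hw hε (hr₀ r hr).1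
      (fun e => div_le_div_of_nonneg_right (he₀ e) hW0.le) (hr₀ r hr).2
  · have hcard : (Fintype.card G.edgeSet : ℝ) ≤ CRSparsifier.totalWeight w := by
      have h := Finset.card_nsmul_le_sum Finset.univ w 1 fun e _ => hw1 e
      simpa [CRSparsifier.totalWeight] using h
    have hcard1 : (1 : ℝ) ≤ Fintype.card G.edgeSet := by
      have : Nonempty G.edgeSet := hG.to_subtype
      exact_mod_cast Fintype.card_pos (α := G.edgeSet)
    obtain ⟨hr0, hbound⟩ := CRSparsifier.union_bound_of_sample_size (hcard1.trans hcard) hcard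
      (CRSparsifier.norm_boundaryMatrix_pos o w hG hw)
      (CRSparsifier.norm_boundaryMatrix_sq_le o w fun e => (hw e).le) hε hδ hγ hr
    exact CRSparsifier.sampleLaw_isMultiplicativeSparsifier o w hG hw hε (Nat.cast_pos.1 hr0)
      (fun e => div_le_div_of_nonneg_right (hw1 e) hW0.le) hbound
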